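/- Let $m,n\ge 2$ be integers and put $d=nm^{n-1}$. Let $\mathbb{TS}(\mathbb C^n,m+1)=\mathbb C^n\otimes \mathrm S^m(\mathbb C^n)$ be the space of tensors $\mathcal T=(t_{ii_1\dots i_m})$ of order $m+1$ and dimension $n$ with complex entries that are symmetric in the last $m$ indices. For such $\mathcal T$ let $(\mathcal T\mathbf x^m)_i=\sum_{i_1,\dots,i_m=1}^n t_{ii_1\dots i_m}x_{i_1}\cdots x_{i_m}$, and let $\chi_{\mathcal T}(\lambda)=\det(\lambda\mathcal I-\mathcal T)$ be its characteristic polynomial, that is, the resultant of the $n$ forms $\lambda x_i^m-(\mathcal T\mathbf x^m)_i$ in $x_1,\dots,x_n$ (given by Macaulay's formula, and normalized so that it is monic in $\lambda$); it has degree $d$. Let $$\phi:\mathbb{TS}(\mathbb C^n,m+1)\to\mathbb C^{d}/\mathfrak S(d)$$ send $\mathcal T$ to the multiset of the $d$ roots of $\chi_{\mathcal T}$ (the eigenvalues of $\mathcal T$, counted with algebraic multiplicity). Call $\phi$ dominant if its image contains a Zariski open dense subset of $\mathbb C^{d}/\mathfrak S(d)$. Then: 1. If $\phi$ is dominant, then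 $n=2$ or $(n,m)\in\{(3,2),(4,2),(3,3)\}$. 2. $\dim_{\mathbb C}\mathbb{TS}(\mathbb C^n,m+1)=n\binom{n+m-1}{m}$. 3. If $n\ne 2$ and $(n,m)\notin\{(3,2),(4,2),(3,3)\}$, then $n\binom{n+m-1}{m}<nm^{n-1}$. 4. If $\phi$ is dominant, then $nm^{n-1}\le\dim_{\mathbb C}\mathbb{TS}(\mathbb C^n,m+1)$. -/

import Mathlib

/-! ### Tensors -/

/-- The space of tensors of order `m + 1` and dimension `n` with complex entries; the entry
`t_{i i_1 … i_m}` of `T` is `T i k` with `k = (i_1, …, i_m)`. -/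
abbrev Tensor (n m : ℕ) : Type := Fin n → (Fin m → Fin n) → ℂ

/-- The space `ℂⁿ ⊗ Sᵐ(ℂⁿ)` of tensors of order `m + 1` and dimension `n` all of whose slices
`T_i = (t_{i i_1 … i_m})` are symmetric tensors. -/
def TensorS (n m : ℕ) : Submodule ℂ (Tensor n m) where
  carrier := {T | ∀ (i : Fin n) (σ : Equiv.Perm (Fin m)) (k : Fin m → Fin n), T i (k ∘ σ) = T i k}
  add_mem' := by
    intro S T hS hT i σ k
    simp only [Pi.add_apply, hS i σ k, hT i σ k]
  zero_mem' := by
    intro i σ k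
    rfl
  smul_mem' := by
    intro c T hT i σ k
    simp only [Pi.smul_apply, hT i σ k]

/-- The `i`-th component `(T xᵐ)_i = ∑ t_{i i_1 … i_m} x_{i_1} ⋯ x_{i_m}` of `T xᵐ`, as a
polynomial in `x_1, …, x_n`. -/
noncomputable def tensorForm {n m : ℕ} (T : Tensor n m) (i : Fin n) : MvPolynomial (Fin n) ℂ :=
  ∑ k : Fin m → Fin n, MvPolynomial.C (T i k) * ∏ j, MvPolynomial.X (k j)

/-! ### Resultants by Macaulay's formula -/

/-- The exponents of the monomials of degree `n m - n + 1 = n (m - 1) + 1` in `n` variables. -/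
abbrev MacaulayMonomial (n m : ℕ) : Type :=
  ↥(Finset.finsuppAntidiag (Finset.univ : Finset (Fin n)) (n * (m - 1) + 1))

/-- `x^α` belongs to the block `S_i`: `α_i ≥ m`, and `α_j < m` for `j < i`. -/
def IsPivot {n : ℕ} (m : ℕ) (α : Fin n →₀ ℕ) (i : Fin n) : Prop :=
  m ≤ α i ∧ ∀ j < i, α j < m

/-- A monomial is reduced if exactly one of its exponents is at least `m`. -/
def IsReducedMonomial {n : ℕ} (m : ℕ) (α : Fin n →₀ ℕ) : Prop := ∃! i, m ≤ α i

open Classical in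
/-- The polynomial `x^{α - m e_i} f_i`, where `i` is the index with `x^α ∈ S_i`
(there is exactly one such `i` for the monomials in question). -/
noncomputable def macaulayRow {K : Type*} [CommRing K] {n : ℕ} (m : ℕ)
    (f : Fin n → MvPolynomial (Fin n) K) (α : Fin n →₀ ℕ) : MvPolynomial (Fin n) K :=
  ∑ i : Fin n, if IsPivot m α i then
    MvPolynomial.monomial (α - Finsupp.single i m) 1 * f i else 0

/-- The Macaulay matrix `R` of `n` homogeneous polynomials of degree `m` in `n` variables. -/
noncomputable def macaulayMatrix {K : Type*} [CommRing K] {n : ℕ} (m : ℕ)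
    (f : Fin n → MvPolynomial (Fin n) K) :
    Matrix (MacaulayMonomial n m) (MacaulayMonomial n m) K :=
  Matrix.of fun α β => MvPolynomial.coeff β.1 (macaulayRow m f α.1)

/-- The submatrix `R'` of the Macaulay matrix `R` in which the rows and columns of the reduced
monomials are deleted. -/
noncomputable def macaulaySubmatrix {K : Type*} [CommRing K] {n : ℕ} (m : ℕ)
    (f : Fin n → MvPolynomial (Fin n) K) :
    Matrix {α : MacaulayMonomial n m // ¬ IsReducedMonomial m α.1}
      {α : MacaulayMonomial n m // ¬ IsReducedMonomial m α.1} K :=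
  (macaulayMatrix m f).submatrix Subtype.val Subtype.val

/-! ### The characteristic polynomial and the eigenvalues of a tensor -/

/-- The components of `λ x^{[m]} - T xᵐ`, with coefficients in `ℂ[λ]`. -/
noncomputable def eigenForm {n m : ℕ} (T : Tensor n m) (i : Fin n) :
    MvPolynomial (Fin n) (Polynomial ℂ) :=
  MvPolynomial.C Polynomial.X * MvPolynomial.X i ^ m
    - MvPolynomial.map Polynomial.C (tensorForm T i)

open Classical in
/-- The characteristic polynomial `χ(λ) = det(λ I - T)`, i.e. the resultant of the system
`λ x^{[m]} - T xᵐ`, given by Macaulay's formula `det R / det R'`. Both determinants are monic in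
`λ` and the division in `ℂ[λ]` is exact. -/
noncomputable def tensorCharpoly {n m : ℕ} (T : Tensor n m) : Polynomial ℂ :=
  (macaulayMatrix m (eigenForm T)).det / (macaulaySubmatrix m (eigenForm T)).det

/-- The multiset `σ(T)` of eigenvalues of `T`, counted with algebraic multiplicity. -/
noncomputable def tensorEigenvalues {n m : ℕ} (T : Tensor n m) : Multiset ℂ :=
  (tensorCharpoly T).roots

theorem exists_pivot {n m : ℕ} (hm : 0 < m) (α : MacaulayMonomial n m) :
    ∃ i, IsPivot m α.1 i := by
  classical
  obtain ⟨α, hα⟩ := α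
  rw [Finset.mem_finsuppAntidiag] at hα
  have hex : ∃ i, m ≤ α i := by
    by_contra! h
    have h1 : ∑ i : Fin n, α i ≤ ∑ _i : Fin n, (m - 1) :=
      Finset.sum_le_sum fun i _ => by have := h i; omega
    simp only [Finset.sum_const, Finset.card_univ, Fintype.card_fin, smul_eq_mul] at h1
    rw [hα.1] at h1
    omega
  let s := Finset.univ.filter fun i => m ≤ α i
  have hs : s.Nonempty := by
    obtain ⟨i, hi⟩ := hex
    exact ⟨i, by simp [s, hi]⟩
  refine ⟨s.min' hs, ?_, ?_⟩
  · have := s.min'_mem hs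
    simpa [s] using this
  · intro j hj
    by_contra! h
    have := s.min'_le j (by simp [s, h])
    exact absurd hj (not_lt.mpr this)

theorem macaulayRow_of_pivot {K : Type*} [CommRing K] {n m : ℕ}
    (f : Fin n → MvPolynomial (Fin n) K) (α : Fin n →₀ ℕ) (i : Fin n) (hi : IsPivot m α i) :
    macaulayRow m f α = MvPolynomial.monomial (α - Finsupp.single i m) 1 * f i := by
  classical
  unfold macaulayRow
  rw [Finset.sum_eq_single i]
  · rw [if_pos hi]
  · intro j _ hj
    rw [if_neg]
    intro hj'
    rcases lt_trichotomy i j with h | h | h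
    · exact absurd hi.1 (not_le.mpr (hj'.2 i h))
    · exact hj h.symm
    · exact absurd hj'.1 (not_le.mpr (hi.2 j h))
  · simp

open Classical in
theorem macaulayMatrix_eigenForm {n m : ℕ} (hm : 0 < m) (T : Tensor n m) :
    macaulayMatrix m (eigenForm T) = (macaulayMatrix m (tensorForm T)).charmatrix := by
  ext1 α β
  obtain ⟨i, hi⟩ := exists_pivot hm α
  have hle : Finsupp.single i m ≤ α.1 := by
    rw [Finsupp.single_le_iff]; exact hi.1
  have e1 : MvPolynomial.monomial (α.1 - Finsupp.single i m) (1 : Polynomial ℂ)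
      * (MvPolynomial.C Polynomial.X * MvPolynomial.X i ^ m)
      = MvPolynomial.monomial α.1 Polynomial.X := by
    rw [MvPolynomial.X_pow_eq_monomial, MvPolynomial.C_mul_monomial,
      MvPolynomial.monomial_mul, tsub_add_cancel_of_le hle]
    simp
  have e2 : MvPolynomial.monomial (α.1 - Finsupp.single i m) (1 : Polynomial ℂ)
      * MvPolynomial.map Polynomial.C (tensorForm T i)
      = MvPolynomial.map Polynomial.C
        (MvPolynomial.monomial (α.1 - Finsupp.single i m) 1 * tensorForm T i) := by
    rw [map_mul, MvPolynomial.map_monomial, Polynomial.C_1]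
  simp only [macaulayMatrix, Matrix.of_apply, Matrix.charmatrix_apply,
    macaulayRow_of_pivot _ _ i hi, eigenForm]
  rw [mul_sub, e1, e2, MvPolynomial.coeff_sub, MvPolynomial.coeff_map,
    MvPolynomial.coeff_monomial, Matrix.diagonal_apply]
  simp only [Subtype.ext_iff]

open Classical in
theorem macaulaySubmatrix_eigenForm {n m : ℕ} (hm : 0 < m) (T : Tensor n m) :
    macaulaySubmatrix m (eigenForm T) = (macaulaySubmatrix m (tensorForm T)).charmatrix := by
  unfold macaulaySubmatrix
  rw [macaulayMatrix_eigenForm hm]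
  ext1 α β
  simp only [Matrix.submatrix_apply, Matrix.charmatrix_apply, Matrix.diagonal_apply,
    Subtype.ext_iff]

theorem card_reduced {n m : ℕ} (hn : 0 < n) (hm : 0 < m) :
    Nat.card {α : MacaulayMonomial n m // IsReducedMonomial m α.1} = n * m ^ (n - 1) := by
  classical
  obtain ⟨k, rfl⟩ : ∃ k, n = k + 1 := ⟨n - 1, by omega⟩
  have hbd : ∀ β : Fin k → Fin m, (∑ j, (β j : ℕ)) ≤ k * (m - 1) := by
    intro β
    have h1 : ∑ j, (β j : ℕ) ≤ ∑ _j : Fin k, (m - 1) :=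
      Finset.sum_le_sum fun j _ => by have := (β j).2; omega
    simpa using h1
  have hd : (k + 1) * (m - 1) + 1 = k * (m - 1) + m := by
    rw [Nat.succ_mul]; omega
  let g : Fin (k + 1) × (Fin k → Fin m) → (Fin (k + 1) →₀ ℕ) := fun p =>
    Finsupp.equivFunOnFinite.symm
      (p.1.insertNth (α := fun _ => ℕ) ((k + 1) * (m - 1) + 1 - ∑ j, (p.2 j : ℕ))
        (fun j => (p.2 j : ℕ)))
  have g_same : ∀ p, g p p.1 = (k + 1) * (m - 1) + 1 - ∑ j, (p.2 j : ℕ) := by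
    intro p; simp [g]
  have g_succ : ∀ p j, g p (p.1.succAbove j) = (p.2 j : ℕ) := by
    intro p j; simp [g]
  have g_ge : ∀ p, m ≤ g p p.1 := by
    intro p; rw [g_same]; have := hbd p.2; omega
  have g_uniq : ∀ p i, m ≤ g p i → i = p.1 := by
    intro p i hi
    rcases Fin.eq_self_or_eq_succAbove p.1 i with h | ⟨j, rfl⟩
    · exact h
    · rw [g_succ] at hi
      exact absurd (p.2 j).2 (not_lt.mpr hi)
  have g_mem : ∀ p, g p ∈ Finset.finsuppAntidiag (Finset.univ : Finset (Fin (k + 1)))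
      ((k + 1) * (m - 1) + 1) := by
    intro p
    rw [Finset.mem_finsuppAntidiag]
    refine ⟨?_, Finset.subset_univ _⟩
    rw [Fin.sum_univ_succAbove _ p.1, g_same]
    simp only [g_succ]
    have := hbd p.2
    omega
  let G : Fin (k + 1) × (Fin k → Fin m) →
      {α : MacaulayMonomial (k + 1) m // IsReducedMonomial m α.1} := fun p =>
    ⟨⟨g p, g_mem p⟩, ⟨p.1, g_ge p, g_uniq p⟩⟩
  have hG : Function.Bijective G := by
    constructor
    · intro p q hpq
      have h : g p = g q := congrArg (fun a => a.1.1) hpq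
      have h1 : p.1 = q.1 := g_uniq q p.1 (h ▸ g_ge p)
      obtain ⟨i, β⟩ := p
      obtain ⟨i', β'⟩ := q
      obtain rfl : i = i' := h1
      congr 1
      funext j
      apply Fin.ext
      have h2 := g_succ (i, β) j
      rw [h] at h2
      exact h2.symm.trans (g_succ (i, β') j)
    · rintro ⟨⟨α, hα⟩, i, hi, hu⟩
      have hlt : ∀ j, α (i.succAbove j) < m := by
        intro j
        by_contra! h
        exact Fin.succAbove_ne i j (hu _ h)
      refine ⟨(i, fun j => ⟨α (i.succAbove j), hlt j⟩), ?_⟩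
      apply Subtype.ext
      apply Subtype.ext
      ext l
      change g _ l = α l
      rcases Fin.eq_self_or_eq_succAbove i l with rfl | ⟨j, rfl⟩
      · rw [Finset.mem_finsuppAntidiag, Fin.sum_univ_succAbove _ l] at hα
        have h3 := g_same (l, fun j => ⟨α (l.succAbove j), hlt j⟩)
        simp only at h3
        rw [h3]
        have := hα.1
        omega
      · exact g_succ (i, fun j => ⟨α (i.succAbove j), hlt j⟩) j
  rw [← Nat.card_congr (Equiv.ofBijective G hG)]
  simp

theorem tensorEigenvalues_card {n m : ℕ} (hn : 0 < n) (hm : 0 < m) (T : Tensor n m) :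
    (tensorEigenvalues T).card = n * m ^ (n - 1) := by
  classical
  unfold tensorEigenvalues tensorCharpoly
  rw [IsAlgClosed.card_roots_eq_natDegree, macaulayMatrix_eigenForm hm,
    macaulaySubmatrix_eigenForm hm]
  change ((macaulayMatrix m (tensorForm T)).charpoly /
    (macaulaySubmatrix m (tensorForm T)).charpoly).natDegree = _
  rw [← Polynomial.divByMonic_eq_div _ (Matrix.charpoly_monic _),
    Polynomial.natDegree_divByMonic _ (Matrix.charpoly_monic _),
    Matrix.charpoly_natDegree_eq_dim, Matrix.charpoly_natDegree_eq_dim,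
    ← card_reduced hn hm, Nat.card_eq_fintype_card]
  have := Fintype.card_subtype_compl (fun α : MacaulayMonomial n m => IsReducedMonomial m α.1)
  have h2 := Fintype.card_subtype_le (fun α : MacaulayMonomial n m => IsReducedMonomial m α.1)
  rw [this]
  omega

/-- The multiset-valued eigenvalue map `φ`, on the tensors with symmetric slices, with values in
the symmetric product `ℂ^d / 𝔖(d)`, `d = n m^{n-1}` (multisets of total multiplicity `d`). -/
noncomputable def eigenvalueMap {n m : ℕ} (hn : 0 < n) (hm : 0 < m) (T : TensorS n m) :
    Sym ℂ (n * m ^ (n - 1)) :=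
  ⟨tensorEigenvalues T.1, tensorEigenvalues_card hn hm T.1⟩

/-! ### Zariski topologies and dominance -/

/-- A set of common zeros in `ℂ^d` of some polynomials in `d` variables. -/
def IsAlgebraicSet {d : ℕ} (Z : Set (Fin d → ℂ)) : Prop :=
  ∃ S : Set (MvPolynomial (Fin d) ℂ), Z = {x | ∀ p ∈ S, MvPolynomial.eval x p = 0}

/-- The Zariski topology on `ℂ^d`. -/
@[reducible] def zariskiTopology (d : ℕ) : TopologicalSpace (Fin d → ℂ) :=
  TopologicalSpace.ofClosed {Z | IsAlgebraicSet Z}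
    ⟨{1}, by ext x; simp⟩
    (by
      intro A hA
      refine ⟨{p | ∃ Z ∈ A, ∀ x ∈ Z, MvPolynomial.eval x p = 0}, ?_⟩
      ext x
      constructor
      · rintro hx p ⟨Z, hZ, hp⟩
        exact hp x (hx Z hZ)
      · intro hx Z hZ
        obtain ⟨S, rfl⟩ := hA hZ
        intro p hp
        exact hx p ⟨_, hZ, fun y hy => hy p hp⟩)
    (by
      rintro _ ⟨S, rfl⟩ _ ⟨S', rfl⟩
      refine ⟨{r | ∃ p ∈ S, ∃ q ∈ S', r = p * q}, ?_⟩
      ext x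
      constructor
      · rintro (hx | hx) _ ⟨p, hp, q, hq, rfl⟩
        · simp [hx p hp]
        · simp [hx q hq]
      · intro hx
        by_contra hcon
        simp only [Set.mem_union, Set.mem_ofPred_eq, not_or, not_forall] at hcon
        obtain ⟨⟨p, hp, hpx⟩, ⟨q, hq, hqx⟩⟩ := hcon
        have := hx _ ⟨p, hp, q, hq, rfl⟩
        rw [map_mul] at this
        exact (mul_ne_zero hpx hqx) this)

/-- The quotient map `ℂ^d → ℂ^d / 𝔖(d)`, which sends `x` to the multiset `{x_1, …, x_d}`. -/
def symQuotientMap (d : ℕ) (x : Fin d → ℂ) : Sym ℂ d :=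
  ⟨Finset.univ.val.map x, by simp⟩

/-- The Zariski topology on `ℂ^d / 𝔖(d)`: the quotient topology of the Zariski topology of `ℂ^d`,
so the closed sets correspond to the `𝔖(d)`-invariant algebraic sets in `ℂ^d`. -/
@[reducible] def zariskiTopologySym (d : ℕ) : TopologicalSpace (Sym ℂ d) :=
  TopologicalSpace.coinduced (symQuotientMap d) (zariskiTopology d)

/-- A map into `ℂ^d / 𝔖(d)` is dominant if its image contains a Zariski open dense subset. -/
def IsDominantSym {X : Type*} {d : ℕ} (φ : X → Sym ℂ d) : Prop :=
  ∃ U : Set (Sym ℂ d), @IsOpen _ (zariskiTopologySym d) U ∧ @Dense _ (zariskiTopologySym d) U ∧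
    U ⊆ Set.range φ

/-! The core is the bound `d ≤ D`, where `d = n * m ^ (n - 1)` and `D` is the dimension of `TensorS
n m`. The coefficients of the characteristic polynomial are polynomials in `D` coordinates of the
tensor: the divisor in Macaulay's quotient is monic, so the division can be done once over the
polynomial ring and then specialized (`genericCharpoly_map`). If `D < d`, these `d` polynomials
satisfy a relation `F ≠ 0`. By Vieta they are, up to sign, the elementary symmetric functions of the
eigenvalues, so dominance makes `F(e_1, …, e_d)` vanish identically on `ℂ^d`, contradicting the
algebraic independence of the `e_i`.

Counting multisets of indices gives `D`, and an induction on the dimension compares the binomial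
coefficient with the power of `m`. -/

theorem symQuotientMap_surjective (d : ℕ) : Function.Surjective (symQuotientMap d) := by
  rintro ⟨s, rfl⟩
  refine ⟨fun i => s.toList.get (i.cast (by simp)), ?_⟩
  apply Subtype.ext
  change Multiset.map _ (Finset.univ : Finset (Fin s.card)).val = s
  rw [Fin.univ_val_map]
  conv_rhs => rw [← s.coe_toList]
  congr 1
  apply List.ext_get
  · simp
  · intro i h1 h2
    simp

/-! ### Dominance and polynomial relations -/

/-- An algebraically defined map from an affine space of smaller dimension satisfies a polynomial
relation. -/
theorem exists_polynomial_relation {D d : ℕ} (h : D < d) (c : Fin d → MvPolynomial (Fin D) ℂ) :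
    ∃ F : MvPolynomial (Fin d) ℂ, F ≠ 0 ∧ MvPolynomial.aeval c F = 0 := by
  by_contra! hcon
  have hind : AlgebraicIndependent ℂ c := by
    rw [algebraicIndependent_iff]
    intro p hp
    by_contra hp0
    exact hcon p hp0 hp
  -- An independent family has at most as many members as the transcendence degree, here `D`.
  have := hind.lift_cardinalMk_le_trdeg
  rw [MvPolynomial.trdeg_of_isDomain] at this
  simp at this
  omega

/-- A dominant map to the symmetric product whose elementary symmetric functions satisfy a common
polynomial relation forces the relation to be trivial. -/
theorem eq_zero_of_isDominantSym {X : Type*} {d : ℕ} {φ : X → Sym ℂ d} (hφ : IsDominantSym φ)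
    (F : MvPolynomial (Fin d) ℂ)
    (hF : ∀ T, MvPolynomial.eval (fun i : Fin d => (φ T : Multiset ℂ).esymm (i + 1)) F = 0) :
    F = 0 := by
  obtain ⟨U, hUo, hUd, hUr⟩ := hφ
  have hpre : @IsOpen _ (zariskiTopology d) (symQuotientMap d ⁻¹' U) :=
    (@isOpen_coinduced _ _ (zariskiTopology d) _ _).1 hUo
  -- In `TopologicalSpace.ofClosed`, openness is by definition algebraicity of the complement.
  have hcl : IsAlgebraicSet (symQuotientMap d ⁻¹' U)ᶜ := hpre
  obtain ⟨S, hS⟩ := hcl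
  have hne : U.Nonempty := by
    have : Nonempty (Sym ℂ d) := ⟨symQuotientMap d 0⟩
    exact @Dense.nonempty _ (zariskiTopologySym d) _ _ hUd
  obtain ⟨u, hu⟩ := hne
  obtain ⟨x, rfl⟩ := symQuotientMap_surjective d u
  have hx : x ∉ {x | ∀ p ∈ S, MvPolynomial.eval x p = 0} := by
    rw [← hS]; simpa using hu
  obtain ⟨p, hpS, hpx⟩ : ∃ p ∈ S, MvPolynomial.eval x p ≠ 0 := by
    simpa using hx
  have hp0 : p ≠ 0 := by
    rintro rfl
    simp at hpx
  let G : MvPolynomial (Fin d) ℂ :=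
    MvPolynomial.aeval (fun i : Fin d => MvPolynomial.esymm (Fin d) ℂ (i + 1)) F
  -- `G` vanishes on the preimage of `U` and `p` off it; as `p ≠ 0`, the polynomial ring being a
  -- domain kills `G`. Of density, only nonemptiness of `U` is used.
  have hG : p * G = 0 := by
    apply MvPolynomial.funext
    intro y
    rw [map_mul, map_zero]
    by_cases hy : symQuotientMap d y ∈ U
    · obtain ⟨T, hT⟩ := hUr hy
      have h1 := hF T
      rw [hT] at h1
      have h2 : MvPolynomial.eval y G = 0 := by
        rw [← h1]
        change MvPolynomial.eval y (MvPolynomial.aeval _ F) = _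
        rw [← MvPolynomial.coe_aeval_eq_eval, RingHom.coe_coe, ← AlgHom.comp_apply,
          MvPolynomial.comp_aeval, ← MvPolynomial.coe_aeval_eq_eval, RingHom.coe_coe]
        congr 2
        funext i
        exact MvPolynomial.aeval_esymm_eq_multiset_esymm (Fin d) ℂ (i + 1) y
      rw [h2, mul_zero]
    · have : y ∈ (symQuotientMap d ⁻¹' U)ᶜ := hy
      rw [hS] at this
      rw [this p hpS, zero_mul]
  have hG0 : G = 0 := (mul_eq_zero.1 hG).resolve_left hp0
  apply MvPolynomial.esymmAlgHom_injective (σ := Fin d) (R := ℂ) (n := d) (by simp)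
  rw [map_zero]
  apply Subtype.ext
  rw [MvPolynomial.esymmAlgHom_apply]
  exact hG0

/-! ### The generic characteristic polynomial -/

/-- The Macaulay matrix of the system `T xᵐ`, as a linear function of `T`. -/
noncomputable def macaulayLinearMap (n m : ℕ) :
    Tensor n m →ₗ[ℂ] Matrix (MacaulayMonomial n m) (MacaulayMonomial n m) ℂ where
  toFun T := macaulayMatrix m (tensorForm T)
  map_add' S T := by
    have h : tensorForm (S + T) = tensorForm S + tensorForm T := by
      funext i
      simp [tensorForm, add_mul, Finset.sum_add_distrib]
    ext α β
    simp only [macaulayMatrix, macaulayRow, Matrix.of_apply, Matrix.add_apply, h, Pi.add_apply,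
      ← MvPolynomial.coeff_add, ← Finset.sum_add_distrib]
    congr 1
    refine Finset.sum_congr rfl fun i _ => ?_
    split_ifs <;> ring
  map_smul' c T := by
    have h : tensorForm (c • T) = c • tensorForm T := by
      funext i
      simp [tensorForm, Finset.smul_sum, MvPolynomial.smul_eq_C_mul, mul_assoc]
    ext α β
    simp only [macaulayMatrix, macaulayRow, Matrix.of_apply, Matrix.smul_apply, h, Pi.smul_apply,
      RingHom.id_apply, ← MvPolynomial.coeff_smul, Finset.smul_sum]
    congr 1
    refine Finset.sum_congr rfl fun i _ => ?_
    split_ifs <;> simp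

section Generic

variable {n m D : ℕ} (b : Fin D → Tensor n m)

/-- The Macaulay matrix of the generic linear combination of the tensors `b j`. -/
noncomputable def genericMacaulayMatrix :
    Matrix (MacaulayMonomial n m) (MacaulayMonomial n m) (MvPolynomial (Fin D) ℂ) :=
  Matrix.of fun α β => ∑ j, MvPolynomial.X j * MvPolynomial.C (macaulayLinearMap n m (b j) α β)

theorem genericMacaulayMatrix_map (s : Fin D → ℂ) :
    (genericMacaulayMatrix b).map (MvPolynomial.eval s)
      = macaulayMatrix m (tensorForm (∑ j, s j • b j)) := by
  change _ = macaulayLinearMap n m _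
  ext α β
  simp [genericMacaulayMatrix, Matrix.sum_apply]

open Classical in
/-- The characteristic polynomial of the generic linear combination of the tensors `b j`. -/
noncomputable def genericCharpoly : Polynomial (MvPolynomial (Fin D) ℂ) :=
  (genericMacaulayMatrix b).charpoly /ₘ
    ((genericMacaulayMatrix b).submatrix Subtype.val Subtype.val :
      Matrix {α : MacaulayMonomial n m // ¬ IsReducedMonomial m α.1}
        {α : MacaulayMonomial n m // ¬ IsReducedMonomial m α.1} _).charpoly

-- Unlike `/`, the operation `/ₘ` makes sense over any commutative ring, hence also for generic
-- coefficients.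
open Classical in
theorem tensorCharpoly_eq_divByMonic (hm : 0 < m) (T : Tensor n m) :
    tensorCharpoly T = (macaulayMatrix m (tensorForm T)).charpoly /ₘ
      (macaulaySubmatrix m (tensorForm T)).charpoly := by
  rw [Polynomial.divByMonic_eq_div _ (Matrix.charpoly_monic _)]
  unfold tensorCharpoly
  rw [macaulayMatrix_eigenForm hm, macaulaySubmatrix_eigenForm hm]
  rfl

-- Division with remainder by a monic polynomial commutes with ring homomorphisms, so exactness of
-- Macaulay's quotient is not needed.
open Classical in
theorem genericCharpoly_map (hm : 0 < m) (s : Fin D → ℂ) :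
    (genericCharpoly b).map (MvPolynomial.eval s) = tensorCharpoly (∑ j, s j • b j) := by
  rw [tensorCharpoly_eq_divByMonic hm, genericCharpoly,
    Polynomial.map_divByMonic _ (Matrix.charpoly_monic _), ← Matrix.charpoly_map,
    ← Matrix.charpoly_map, genericMacaulayMatrix_map, ← Matrix.submatrix_map,
    genericMacaulayMatrix_map]
  rfl

theorem tensorCharpoly_monic (hm : 0 < m) (T : Tensor n m) : (tensorCharpoly T).Monic := by
  classical
  rw [tensorCharpoly_eq_divByMonic hm, Polynomial.Monic,
    Polynomial.leadingCoeff_divByMonic_of_monic (Matrix.charpoly_monic _)]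
  · exact Matrix.charpoly_monic _
  · rw [Polynomial.degree_eq_natDegree (Matrix.charpoly_monic _).ne_zero,
      Polynomial.degree_eq_natDegree (Matrix.charpoly_monic _).ne_zero,
      Matrix.charpoly_natDegree_eq_dim, Matrix.charpoly_natDegree_eq_dim, Nat.cast_le]
    exact Fintype.card_subtype_le _

theorem esymm_tensorEigenvalues (hn : 0 < n) (hm : 0 < m) (T : Tensor n m) {k : ℕ}
    (hk : k ≤ n * m ^ (n - 1)) :
    (tensorEigenvalues T).esymm k
      = (-1) ^ k * (tensorCharpoly T).coeff (n * m ^ (n - 1) - k) := by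
  have hdeg : (tensorCharpoly T).natDegree = n * m ^ (n - 1) := by
    rw [← tensorEigenvalues_card hn hm T, tensorEigenvalues,
      IsAlgClosed.card_roots_eq_natDegree]
  rw [Polynomial.coeff_eq_esymm_roots_of_card (IsAlgClosed.card_roots_eq_natDegree) (by omega),
    (tensorCharpoly_monic hm T).leadingCoeff, hdeg, Nat.sub_sub_self hk, one_mul, ← mul_assoc,
    ← mul_pow]
  simp [tensorEigenvalues]

end Generic

/-! ### The dimension bound -/

theorem le_finrank_of_isDominantSym {n m : ℕ} (hn : 0 < n) (hm : 0 < m)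
    (h : IsDominantSym (eigenvalueMap hn hm)) :
    n * m ^ (n - 1) ≤ Module.finrank ℂ (TensorS n m) := by
  by_contra! hlt
  let B := Module.finBasis ℂ (TensorS n m)
  let b : Fin (Module.finrank ℂ (TensorS n m)) → Tensor n m := fun j => (B j).1
  -- Vieta's sign is built in, so that entry `i` specializes to `e_{i+1}` of the eigenvalues.
  obtain ⟨F, hF0, hF⟩ := exists_polynomial_relation hlt fun i =>
    (-1) ^ ((i : ℕ) + 1) * (genericCharpoly b).coeff (n * m ^ (n - 1) - (i + 1))
  refine hF0 (eq_zero_of_isDominantSym h F fun T => ?_)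
  have hT : T.1 = ∑ j, B.repr T j • b j :=
    (congrArg Subtype.val (B.sum_repr T)).symm.trans (map_sum (TensorS n m).subtype _ _)
  have := congrArg (MvPolynomial.eval (B.repr T)) hF
  rw [map_zero, ← MvPolynomial.coe_aeval_eq_eval, RingHom.coe_coe, ← AlgHom.comp_apply,
    MvPolynomial.comp_aeval] at this
  rw [← this, ← MvPolynomial.coe_aeval_eq_eval, RingHom.coe_coe]
  congr 2
  funext i
  change (tensorEigenvalues T.1).esymm _ = MvPolynomial.aeval (B.repr T) _
  rw [esymm_tensorEigenvalues hn hm _ (by omega), hT, ← genericCharpoly_map b hm]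
  simp

/-! ### The dimension of the tensor space -/

/-- Tuples with the same multiset of values have the same sorted rearrangement; `σ` undoes one
sorting permutation and applies the other. -/
theorem ofFn_perm_iff_exists_comp_perm {n m : ℕ} (k l : Fin m → Fin n) :
    (List.ofFn k).Perm (List.ofFn l) ↔ ∃ σ : Equiv.Perm (Fin m), k = l ∘ σ := by
  constructor
  · intro h
    have h1 : k ∘ Tuple.sort k = l ∘ Tuple.sort l :=
      List.ofFn_injective <| List.Perm.eq_of_pairwise'
        (Tuple.monotone_sort k).sortedLE_ofFn.pairwise
        (Tuple.monotone_sort l).sortedLE_ofFn.pairwise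
        ((((Tuple.sort k).ofFn_comp_perm k).trans h).trans ((Tuple.sort l).ofFn_comp_perm l).symm)
    refine ⟨(Tuple.sort k)⁻¹.trans (Tuple.sort l), ?_⟩
    funext i
    simpa using congrFun h1 ((Tuple.sort k)⁻¹ i)
  · rintro ⟨σ, rfl⟩
    exact σ.ofFn_comp_perm l

/-- The multiset of the values of a tuple. -/
def tupleSym (n m : ℕ) (k : Fin m → Fin n) : Sym (Fin n) m := ⟨List.ofFn k, by simp⟩

theorem tupleSym_comp_perm {n m : ℕ} (k : Fin m → Fin n) (σ : Equiv.Perm (Fin m)) :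
    tupleSym n m (k ∘ σ) = tupleSym n m k :=
  Subtype.ext (Multiset.coe_eq_coe.2 (σ.ofFn_comp_perm k))

theorem exists_comp_perm_of_tupleSym_eq {n m : ℕ} {k l : Fin m → Fin n}
    (h : tupleSym n m k = tupleSym n m l) : ∃ σ : Equiv.Perm (Fin m), k = l ∘ σ :=
  (ofFn_perm_iff_exists_comp_perm k l).1 (Multiset.coe_eq_coe.1 (congrArg Subtype.val h))

theorem tupleSym_surjective (n m : ℕ) : Function.Surjective (tupleSym n m) := by
  rintro ⟨s, hs⟩
  induction s using Quot.inductionOn with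
  | h l =>
    subst hs
    exact ⟨l.get, Subtype.ext (congrArg (fun l : List (Fin n) => (l : Multiset (Fin n)))
      (List.ofFn_get l))⟩

/-- A tensor with symmetric slices is a family of functions on the multisets of indices. -/
noncomputable def tensorSEquiv (n m : ℕ) : (Fin n → Sym (Fin n) m → ℂ) ≃ₗ[ℂ] TensorS n m where
  toFun f := ⟨fun i k => f i (tupleSym n m k), fun i σ k => congrArg (f i) (tupleSym_comp_perm k σ)⟩
  map_add' _ _ := rfl
  map_smul' _ _ := rfl
  invFun T := fun i s => T.1 i (Function.surjInv (tupleSym_surjective n m) s)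
  left_inv f := by
    funext i s
    exact congrArg (f i) (Function.surjInv_eq (tupleSym_surjective n m) s)
  right_inv T := by
    apply Subtype.ext
    funext i k
    obtain ⟨σ, hσ⟩ := exists_comp_perm_of_tupleSym_eq
      (Function.surjInv_eq (tupleSym_surjective n m) (tupleSym n m k))
    exact (congrArg (T.1 i) hσ).trans (T.2 i σ k)

theorem finrank_tensorS (n m : ℕ) :
    Module.finrank ℂ (TensorS n m) = n * (n + m - 1).choose m := by
  rw [← (tensorSEquiv n m).finrank_eq, Module.finrank_pi_fintype]
  simp [Sym.card_sym_eq_choose]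

/-! ### Binomial coefficients against powers -/

/-- The step multiplies the binomial by `(n + m + 1) / (n + 1) ≤ m` and the power by `m`. -/
theorem choose_add_lt_pow_succ {n m : ℕ} (hn : 1 ≤ n) (hm : 2 ≤ m)
    (h : (n + m).choose m < m ^ n) : (n + 1 + m).choose m < m ^ (n + 1) := by
  have h1 : (n + m + 1).choose m * (n + 1) = (n + m).choose m * (n + m + 1) := by
    rw [Nat.choose_mul_succ_eq, show n + m + 1 - m = n + 1 by omega]
  have h2 : n + m + 1 ≤ m * (n + 1) := by nlinarith
  rw [show n + 1 + m = n + m + 1 by ring]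
  have h3 : (n + m + 1).choose m * (n + 1) < m ^ (n + 1) * (n + 1) :=
    calc (n + m + 1).choose m * (n + 1) = (n + m).choose m * (n + m + 1) := h1
      _ < m ^ n * (n + m + 1) := by gcongr
      _ ≤ m ^ n * (m * (n + 1)) := by gcongr
      _ = m ^ (n + 1) * (n + 1) := by ring
  exact lt_of_mul_lt_mul_right h3 (Nat.zero_le _)

theorem choose_add_lt_pow_of_le {n k m : ℕ} (hn : 1 ≤ n) (hm : 2 ≤ m) (hk : n ≤ k)
    (h : (n + m).choose m < m ^ n) : (k + m).choose m < m ^ k := by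
  induction k, hk using Nat.le_induction with
  | base => exact h
  | succ k hk ih => exact choose_add_lt_pow_succ (hn.trans hk) hm ih

/-- The induction starts at `15 < 16` for `m = 2`, `k = 4`, at `20 < 27` for `m = 3`, `k = 3`, and
at `(m + 2)(m + 1) / 2 < m ^ 2` for `m ≥ 4`, `k = 2`. With `k = n - 1`, the excluded pairs are the
listed exceptions with `n ≥ 3`. -/
theorem choose_add_lt_pow {k m : ℕ} (hk : 2 ≤ k) (hm : 2 ≤ m)
    (h2 : m = 2 → 4 ≤ k) (h3 : m = 3 → 3 ≤ k) : (k + m).choose m < m ^ k := by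
  rcases lt_or_ge m 4 with h | h
  · interval_cases m
    · exact choose_add_lt_pow_of_le (by norm_num) hm (h2 rfl) (by decide)
    · exact choose_add_lt_pow_of_le (by norm_num) hm (h3 rfl) (by decide)
  · refine choose_add_lt_pow_of_le (by norm_num) hm hk ?_
    have : (2 + m).choose m * 2 = (m + 2) * (m + 1) := by
      rw [add_comm 2 m, Nat.choose_symm_add, Nat.choose_two_right]
      exact Nat.div_mul_cancel (Nat.even_mul_pred_self (m + 2)).two_dvd
    nlinarith

theorem mul_choose_lt_mul_pow {n m : ℕ} (hn : 2 ≤ n) (hm : 2 ≤ m)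
    (h : ¬ (n = 2 ∨ (n, m) = (3, 2) ∨ (n, m) = (4, 2) ∨ (n, m) = (3, 3))) :
    n * (n + m - 1).choose m < n * m ^ (n - 1) := by
  simp only [Prod.mk.injEq] at h
  rw [show n + m - 1 = n - 1 + m by omega]
  exact Nat.mul_lt_mul_of_pos_left
    (choose_add_lt_pow (by omega) hm (by omega) (by omega)) (by omega)

theorem proposition2p9 (n m : ℕ) (hn : 2 ≤ n) (hm : 2 ≤ m) :
    (IsDominantSym (eigenvalueMap (n := n) (m := m) (by omega) (by omega)) →
      n = 2 ∨ (n, m) = (3, 2) ∨ (n, m) = (4, 2) ∨ (n, m) = (3, 3)) ∧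
    Module.finrank ℂ (TensorS n m) = n * (n + m - 1).choose m ∧
    (¬ (n = 2 ∨ (n, m) = (3, 2) ∨ (n, m) = (4, 2) ∨ (n, m) = (3, 3)) →
      n * (n + m - 1).choose m < n * m ^ (n - 1)) ∧
    (IsDominantSym (eigenvalueMap (n := n) (m := m) (by omega) (by omega)) →
      n * m ^ (n - 1) ≤ Module.finrank ℂ (TensorS n m)) := by
  refine ⟨fun h => ?_, finrank_tensorS n m, mul_choose_lt_mul_pow hn hm,
    le_finrank_of_isDominantSym _ _⟩
  by_contra hcon
  have h1 := le_finrank_of_isDominantSym _ _ h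
  rw [finrank_tensorS] at h1
  exact absurd (mul_choose_lt_mul_pow hn hm hcon) (not_lt.mpr h1)
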